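/- Let $D\ge 1$, and let $V=\mathcal B_{sa}(\mathbb C^D)$ be the real vector space (of dimension $n=D^2$) of Hermitian $D\times D$ complex matrices. Let $\mathcal D(\mathbb C^D)=\{\rho\in V:\rho\ge 0,\ \mathrm{tr}\,\rho=1\}$ be the set of states and let $\Delta(\mathbb C^D)=\mathrm{conv}\big(\mathcal D(\mathbb C^D)\cup-\mathcal D(\mathbb C^D)\big)$ (this is the Hermitian part of the unit ball for the trace class norm). An ellipsoid in $V$ is the image of the Euclidean unit ball $B_2^n\subset\mathbb R^n$ under an invertible affine map $\mathbb R^n\to V$; the Löwner ellipsoid of a convex body $K\subset V$ is the unique ellipsoid of minimal volume containing $K$ (volume being Lebesgue measure on $V$, in any normalization). If $\mathcal E=T(B_2^n)$ with $T:\mathbb R^n\to V$ linear and invertible, the scalar product determined by $\mathcal E$ is $\langle A,B\rangle_{\mathcal E}=\langle T^{-1}A,T^{-1}B\rangle$, so that $\mathcal E$ is its unit ball. Then the Löwner ellipsoid $\mathrm{L\ddot{o}w}(\Delta(\mathbb C^D))$ of $\Delta(\mathbb C^D)$ exists, is centred at the origin, and is determined by the following scalar product, defined for $A,B\in V$ by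 $$\langle A,B\rangle_{\mathrm{L\ddot{o}w}(\Delta(\mathbb C^D))}=\Big(1+\frac1D\Big)\mathrm{tr}(AB)-\frac1D\,\mathrm{tr}(A)\,\mathrm{tr}(B).$$ -/

import Mathlib

open scoped ComplexOrder

/-- `E` is an ellipsoid of the finite-dimensional real vector space `V`: the image of the closed
Euclidean unit ball of `ℝⁿ`, `n = dim V`, under an invertible affine map (so `E` has nonempty
interior, and its centre is arbitrary). -/
def IsEllipsoid {V : Type*} [AddCommGroup V] [Module ℝ V] (E : Set V) : Prop :=
  ∃ T : EuclideanSpace ℝ (Fin (Module.finrank ℝ V)) ≃ᵃ[ℝ] V,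
    E = T '' Metric.closedBall (0 : EuclideanSpace ℝ (Fin (Module.finrank ℝ V))) 1

/-- `E` is the Löwner ellipsoid of `K`: the unique ellipsoid of minimal volume containing `K`. -/
def IsLownerEllipsoid {V : Type*} [AddCommGroup V] [Module ℝ V] [MeasurableSpace V]
    (vol : MeasureTheory.Measure V) (K E : Set V) : Prop :=
  IsEllipsoid E ∧ K ⊆ E ∧
    ∀ E' : Set V, IsEllipsoid E' → K ⊆ E' → E' ≠ E → vol E < vol E'

/-- `E` is an ellipsoid centred at the origin and `B` is the scalar product it determines:
`E = T(B₂ⁿ)` with `T` linear and invertible, and `B x y = ⟨T⁻¹ x, T⁻¹ y⟩`. -/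
def IsScalarProductOf {V : Type*} [AddCommGroup V] [Module ℝ V]
    (E : Set V) (B : V → V → ℝ) : Prop :=
  ∃ T : EuclideanSpace ℝ (Fin (Module.finrank ℝ V)) ≃ₗ[ℝ] V,
    E = T '' Metric.closedBall (0 : EuclideanSpace ℝ (Fin (Module.finrank ℝ V))) 1 ∧
      ∀ x y : V, B x y = inner ℝ (T.symm x) (T.symm y)

/-- The real vector space of Hermitian `D × D` complex matrices. -/
abbrev HermitianSpace (D : ℕ) : Type := selfAdjoint (Matrix (Fin D) (Fin D) ℂ)

/-- The set of states (density matrices) on `ℂ^D`. -/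
def states (D : ℕ) : Set (HermitianSpace D) :=
  {ρ | (ρ : Matrix (Fin D) (Fin D) ℂ).PosSemidef ∧ (ρ : Matrix (Fin D) (Fin D) ℂ).trace = 1}

/-- The symmetrization `Δ(ℂ^D)` of the set of states. -/
def symmStates (D : ℕ) : Set (HermitianSpace D) :=
  convexHull ℝ (states D ∪ -states D)

/-! By John's criterion, a ball is the unique smallest ellipsoid around a symmetric body `K` if it
contains `K` and touches it at points `± x i` forming a weighted tight frame
(`measure_closedBall_lt_of_tight_frame`). For an ellipsoid `T(B)` containing these points, let `M`
be the linear part of `T⁻¹`. Averaging over the frame gives `tr (M Mᵀ) ≤ n`, while volume at most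
that of the ball gives `|det M| ≥ 1`. Equality in AM-GM for the eigenvalues of `M Mᵀ` makes `M`
orthogonal and the centre zero.

Here the ball is that of `lownerForm`, and the contact points are pure states `ψψ*`. The tight frame
identity is quadratic in `ψψ*`, so it needs only a finite projective 2-design. The standard basis
together with the normalised vectors of fourth roots of unity is one, suitably weighted
(`sum_designWeight_mul_lownerForm_sq`). -/

/-- The arithmetic-geometric mean inequality, normalised, with its equality case. -/
theorem eq_one_of_sum_le_card_of_one_le_prod {ι : Type*} [Fintype ι] (f : ι → ℝ)
    (hf : ∀ i, 0 ≤ f i) (hsum : ∑ i, f i ≤ Fintype.card ι) (hprod : 1 ≤ ∏ i, f i) :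
    ∀ i, f i = 1 := by
  have hle : ∀ i, f i ≤ Real.exp (f i - 1) := fun i => by
    linarith [Real.add_one_le_exp (f i - 1)]
  by_contra! ⟨j, hj⟩
  have hpos : ∀ i, 0 < f i := fun i => by
    refine (hf i).lt_of_ne fun h => ?_
    rw [Finset.prod_eq_zero (Finset.mem_univ i) h.symm] at hprod
    linarith
  have hlt : ∏ i, f i < ∏ i, Real.exp (f i - 1) :=
    Finset.prod_lt_prod (fun i _ => hpos i) (fun i _ => hle i)
      ⟨j, Finset.mem_univ j, by linarith [Real.add_one_lt_exp (sub_ne_zero.2 hj)]⟩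
  rw [← Real.exp_sum] at hlt
  have : Real.exp (∑ i, (f i - 1)) ≤ 1 := by
    rw [Real.exp_le_one_iff, Finset.sum_sub_distrib]
    simpa using hsum
  linarith

/-! ### John's criterion in a Euclidean space. -/

section InnerProduct

variable {F : Type*} [NormedAddCommGroup F] [InnerProductSpace ℝ F] [FiniteDimensional ℝ F]

theorem LinearMap.trace_comp_adjoint_eq_sum {ι : Type*} [Fintype ι] (M : F →ₗ[ℝ] F)
    (b : OrthonormalBasis ι ℝ F) :
    LinearMap.trace ℝ F (M ∘ₗ M.adjoint) = ∑ k, ‖M.adjoint (b k)‖ ^ 2 := by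
  rw [LinearMap.trace_eq_sum_inner _ b]
  refine Finset.sum_congr rfl fun k _ => ?_
  rw [LinearMap.comp_apply, ← LinearMap.adjoint_inner_left, real_inner_self_eq_norm_sq]

theorem LinearMap.det_adjoint_real (M : F →ₗ[ℝ] F) :
    LinearMap.det M.adjoint = LinearMap.det M := by
  set b := stdOrthonormalBasis ℝ F
  rw [← LinearMap.det_toMatrix b.toBasis, ← LinearMap.det_toMatrix b.toBasis M,
    LinearMap.toMatrix_adjoint, Matrix.det_conjTranspose, star_trivial]

/-- If `tr (M Mᵀ) ≤ dim F` and `|det M| ≥ 1` then `M` is orthogonal. -/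
theorem LinearMap.comp_adjoint_eq_id_of_one_le_abs_det (M : F →ₗ[ℝ] F)
    (htr : LinearMap.trace ℝ F (M ∘ₗ M.adjoint) ≤ Module.finrank ℝ F)
    (hdet : 1 ≤ |LinearMap.det M|) : M ∘ₗ M.adjoint = LinearMap.id := by
  have hsymm : (M ∘ₗ M.adjoint).IsSymmetric := M.isSymmetric_self_comp_adjoint
  have hnn : ∀ i, 0 ≤ hsymm.eigenvalues rfl i := fun i => by
    refine eigenvalue_nonneg_of_nonneg (hsymm.hasEigenvalue_eigenvalues rfl i) fun x => ?_
    rw [LinearMap.comp_apply, ← LinearMap.adjoint_inner_left]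
    exact real_inner_self_nonneg
  -- The eigenvalues of `M Mᵀ` are nonnegative, with sum at most `n` and product `(det M)² ≥ 1`, so
  -- all equal `1`.
  have hone := eq_one_of_sum_le_card_of_one_le_prod (hsymm.eigenvalues rfl) hnn
    (by
      have := hsymm.trace_eq_sum_eigenvalues rfl
      simp only [RCLike.ofReal_real_eq_id, id_eq] at this
      rw [← this]; simpa using htr)
    (by
      have := hsymm.det_eq_prod_eigenvalues rfl
      simp only [RCLike.ofReal_real_eq_id, id_eq] at this
      rw [← this, LinearMap.det_comp, LinearMap.det_adjoint_real]
      rw [← abs_mul_abs_self]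
      nlinarith)
  refine (hsymm.eigenvectorBasis rfl).toBasis.ext fun i => ?_
  simp only [OrthonormalBasis.coe_toBasis, LinearMap.id_apply]
  rw [hsymm.apply_eigenvectorBasis rfl i, hone i]
  simp

/-- The trace of `M Mᵀ`, computed by averaging over a weighted tight frame of unit vectors. -/
theorem trace_comp_adjoint_eq_finrank_mul_sum {ι : Type*} [Fintype ι] (x : ι → F) (w : ι → ℝ)
    (c : ℝ) (hw : ∑ i, w i = 1) (hx : ∀ i, ‖x i‖ = 1)
    (hframe : ∀ v : F, ∑ i, w i * inner ℝ v (x i) ^ 2 = c * ‖v‖ ^ 2) (M : F →ₗ[ℝ] F) :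
    LinearMap.trace ℝ F (M ∘ₗ M.adjoint) = Module.finrank ℝ F * ∑ i, w i * ‖M (x i)‖ ^ 2 := by
  have key : ∀ N : F →ₗ[ℝ] F,
      ∑ i, w i * ‖N (x i)‖ ^ 2 = c * LinearMap.trace ℝ F (N ∘ₗ N.adjoint) := fun N => by
    set b := stdOrthonormalBasis ℝ F
    rw [N.trace_comp_adjoint_eq_sum b, Finset.mul_sum]
    simp_rw [← hframe, LinearMap.adjoint_inner_left]
    rw [Finset.sum_comm]
    refine Finset.sum_congr rfl fun i _ => ?_
    rw [← Finset.mul_sum, ← b.sum_sq_norm_inner_right]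
    simp
  -- Taking `N = id` forces `c * n = 1`.
  have h1 := key LinearMap.id
  simp only [LinearMap.id_apply, hx, one_pow, mul_one, hw, LinearMap.adjoint_id,
    LinearMap.comp_id, LinearMap.trace_id] at h1
  rw [key M, ← mul_assoc, mul_comm _ c, ← h1, one_mul]

open MeasureTheory in
/-- **John's criterion** for symmetric bodies: if `± x i` are unit vectors and the `x i` form a
weighted tight frame, then the unit ball is the unique ellipsoid of least volume containing
all `± x i`. -/
theorem measure_closedBall_lt_of_tight_frame [MeasurableSpace F] [BorelSpace F] (μ : Measure F)
    [μ.IsAddHaarMeasure] {ι : Type*} [Fintype ι] (x : ι → F) (w : ι → ℝ) (c : ℝ)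
    (hw0 : ∀ i, 0 ≤ w i) (hw : ∑ i, w i = 1) (hx : ∀ i, ‖x i‖ = 1)
    (hframe : ∀ v : F, ∑ i, w i * inner ℝ v (x i) ^ 2 = c * ‖v‖ ^ 2) (T : F ≃ᵃ[ℝ] F)
    (hT : ∀ i, x i ∈ T '' Metric.closedBall 0 1) (hT' : ∀ i, -x i ∈ T '' Metric.closedBall 0 1)
    (hne : T '' Metric.closedBall 0 1 ≠ Metric.closedBall (0 : F) 1) :
    μ (Metric.closedBall 0 1) < μ (T '' Metric.closedBall 0 1) := by
  have himg : ∀ y, y ∈ T '' Metric.closedBall 0 1 ↔ ‖T.symm y‖ ≤ 1 := fun y => by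
    constructor
    · rintro ⟨z, hz, rfl⟩
      simpa using hz
    · intro h
      exact ⟨T.symm y, by simpa using h, by simp⟩
  set M : F →ₗ[ℝ] F := (T.symm.linear : F →ₗ[ℝ] F) with hM
  set b : F := T.symm 0 with hb
  have happ : ∀ y, T.symm y = M y + b := fun y => by
    have := T.symm.map_vadd (0 : F) y
    rwa [vadd_eq_add, vadd_eq_add, add_zero] at this
  -- Both `b + M (x i)` and `b - M (x i)` have norm at most `1`; the parallelogram law removes the
  -- cross term.
  have hbound : ∀ i, ‖M (x i)‖ ^ 2 + ‖b‖ ^ 2 ≤ 1 := fun i => by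
    have h1 := (himg _).1 (hT i)
    have h2 := (himg _).1 (hT' i)
    rw [happ] at h1 h2
    rw [map_neg, neg_add_eq_sub, norm_sub_rev] at h2
    have := parallelogram_law_with_norm ℝ (M (x i)) b
    nlinarith [norm_nonneg (M (x i) + b), norm_nonneg (M (x i) - b)]
  have havg : ∑ i, w i * ‖M (x i)‖ ^ 2 + ‖b‖ ^ 2 ≤ 1 := by
    calc ∑ i, w i * ‖M (x i)‖ ^ 2 + ‖b‖ ^ 2
        = ∑ i, w i * (‖M (x i)‖ ^ 2 + ‖b‖ ^ 2) := by
          simp_rw [mul_add]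
          rw [Finset.sum_add_distrib, ← Finset.sum_mul, hw, one_mul]
      _ ≤ ∑ i, w i * 1 := Finset.sum_le_sum fun i _ => mul_le_mul_of_nonneg_left (hbound i) (hw0 i)
      _ = 1 := by simpa using hw
  have htr := trace_comp_adjoint_eq_finrank_mul_sum x w c hw hx hframe M
  have hn : (0 : ℝ) ≤ Module.finrank ℝ F := Nat.cast_nonneg _
  by_contra! hle
  have hvol : μ (T '' Metric.closedBall 0 1)
      = ENNReal.ofReal |LinearMap.det (T.linear : F →ₗ[ℝ] F)| * μ (Metric.closedBall 0 1) := by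
    have : (T '' Metric.closedBall 0 1 : Set F)
        = (fun y => y + T 0) '' ((T.linear : F →ₗ[ℝ] F) '' Metric.closedBall 0 1) := by
      rw [Set.image_image]
      refine Set.image_congr fun y _ => ?_
      simpa using T.map_vadd (0 : F) y
    rw [this, Set.image_add_right, measure_preimage_add_right, Measure.addHaar_image_linearMap]
  have hdetT : |LinearMap.det (T.linear : F →ₗ[ℝ] F)| ≤ 1 := by
    rw [hvol] at hle
    by_contra! h
    refine absurd hle (not_le.2 ?_)
    have h0 : μ (Metric.closedBall (0 : F) 1) ≠ 0 :=
      (Metric.measure_closedBall_pos μ 0 one_pos).ne'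
    have htop : μ (Metric.closedBall (0 : F) 1) ≠ ⊤ := measure_closedBall_lt_top.ne
    calc μ (Metric.closedBall (0 : F) 1) = 1 * μ (Metric.closedBall (0 : F) 1) := (one_mul _).symm
      _ < _ := (ENNReal.mul_lt_mul_iff_left h0 htop).2 (by simpa using h)
  have hdet : 1 ≤ |LinearMap.det M| := by
    have h1 : LinearMap.det M * LinearMap.det (T.linear : F →ₗ[ℝ] F) = 1 := by
      rw [← LinearMap.det_comp]
      have : M ∘ₗ (T.linear : F →ₗ[ℝ] F) = LinearMap.id := by
        ext y
        simp [hM]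
      rw [this, LinearMap.det_id]
    have h2 : |LinearMap.det M| * |LinearMap.det (T.linear : F →ₗ[ℝ] F)| = 1 := by
      rw [← abs_mul, h1, abs_one]
    nlinarith [abs_nonneg (LinearMap.det M)]
  have hiso := M.comp_adjoint_eq_id_of_one_le_abs_det
    (by rw [htr]; nlinarith [sq_nonneg ‖b‖]) hdet
  -- Once `M Mᵀ = 1`, the average of `‖M (x i)‖²` is `1`, leaving no room for `‖b‖²` in `havg`.
  have hb0 : b = 0 := by
    rcases Nat.eq_zero_or_pos (Module.finrank ℝ F) with h | h
    · have := Module.finrank_zero_iff.1 h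
      exact Subsingleton.elim _ _
    · rw [hiso, LinearMap.trace_id] at htr
      have h' : (0 : ℝ) < Module.finrank ℝ F := by exact_mod_cast h
      have : ∑ i, w i * ‖M (x i)‖ ^ 2 = 1 := by
        field_simp at htr
        linarith
      have : ‖b‖ ^ 2 = 0 := le_antisymm (by linarith) (sq_nonneg _)
      simpa using this
  have hiso' : M.adjoint ∘ₗ M = LinearMap.id := (LinearMap.comp_eq_id_comm ℝ F).1 hiso
  have hnorm : ∀ y, ‖M y‖ = ‖y‖ := fun y => by
    rw [← sq_eq_sq₀ (norm_nonneg _) (norm_nonneg _), ← real_inner_self_eq_norm_sq,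
      ← real_inner_self_eq_norm_sq, ← LinearMap.adjoint_inner_left, ← LinearMap.comp_apply,
      hiso', LinearMap.id_apply]
  refine hne (Set.ext fun y => ?_)
  rw [himg, happ, hb0, add_zero, hnorm]
  simp

end InnerProduct

/-! ### Transport of the criterion to an abstract positive definite form. -/

section ScalarProduct

variable {V : Type*} [AddCommGroup V] [Module ℝ V] [FiniteDimensional ℝ V]

/-- A positive definite symmetric form has an orthonormal coordinate system. -/
theorem exists_linearEquiv_inner_symm_apply (B : V → V → ℝ) (hsymm : ∀ x y, B x y = B y x)
    (hadd : ∀ x y z, B (x + y) z = B x z + B y z) (hsmul : ∀ (r : ℝ) x y, B (r • x) y = r * B x y)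
    (hpos : ∀ x, x ≠ 0 → 0 < B x x) :
    ∃ T : EuclideanSpace ℝ (Fin (Module.finrank ℝ V)) ≃ₗ[ℝ] V,
      ∀ x y : V, B x y = inner ℝ (T.symm x) (T.symm y) := by
  have hzero : B 0 0 = 0 := by simpa using hsmul 0 0 0
  let core : InnerProductSpace.Core ℝ V :=
    { inner := B
      conj_inner_symm := fun x y => hsymm y x
      re_inner_nonneg := fun x => by
        by_cases hx : x = 0
        · subst hx; exact hzero.ge
        · exact (hpos x hx).le
      add_left := hadd
      smul_left := fun x y r => hsmul r x y
      definite := fun x hx => by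
        by_contra h
        exact (hpos x h).ne' hx }
  let : NormedAddCommGroup V := core.toNormedAddCommGroup
  let : InnerProductSpace ℝ V := InnerProductSpace.ofCore core.toCore
  let e := (stdOrthonormalBasis ℝ V).repr
  exact ⟨e.symm.toLinearEquiv, fun x y => (e.inner_map_map x y).symm⟩

open MeasureTheory in
/-- **John's criterion** for a symmetric positive definite form `B`: if `K` lies in the unit ball
of `B` and contains `± x i` for a weighted tight frame `x` of unit vectors, then the unit ball of
`B` is the Löwner ellipsoid of `K`. -/
theorem exists_isLownerEllipsoid_isScalarProductOf [TopologicalSpace V] [IsTopologicalAddGroup V]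
    [ContinuousSMul ℝ V] [T2Space V] [MeasurableSpace V] [BorelSpace V] (vol : Measure V)
    [vol.IsAddHaarMeasure] (B : V → V → ℝ) (hsymm : ∀ x y, B x y = B y x)
    (hadd : ∀ x y z, B (x + y) z = B x z + B y z) (hsmul : ∀ (r : ℝ) x y, B (r • x) y = r * B x y)
    (hpos : ∀ x, x ≠ 0 → 0 < B x x) {S : Set V} (hS : ∀ x ∈ S, B x x ≤ 1)
    {ι : Type*} [Fintype ι] (x : ι → V) (w : ι → ℝ) (c : ℝ) (hw0 : ∀ i, 0 ≤ w i)
    (hw : ∑ i, w i = 1) (hx : ∀ i, B (x i) (x i) = 1)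
    (hframe : ∀ v, ∑ i, w i * B v (x i) ^ 2 = c * B v v)
    (hxS : ∀ i, x i ∈ convexHull ℝ S) (hxS' : ∀ i, -x i ∈ convexHull ℝ S) :
    ∃ E : Set V, IsLownerEllipsoid vol (convexHull ℝ S) E ∧ IsScalarProductOf E B := by
  obtain ⟨W, hW⟩ := exists_linearEquiv_inner_symm_apply B hsymm hadd hsmul hpos
  have hnorm : ∀ y, B y y = ‖W.symm y‖ ^ 2 := fun y => by
    rw [hW, real_inner_self_eq_norm_sq]
  refine ⟨W '' Metric.closedBall 0 1, ⟨⟨W.toAffineEquiv, rfl⟩, ?_, ?_⟩, W, rfl, hW⟩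
  · refine convexHull_min (fun y hy => ⟨W.symm y, ?_, by simp⟩)
      ((convex_closedBall _ _).linear_image W.toLinearMap)
    have := hS y hy
    rw [hnorm] at this
    rw [mem_closedBall_zero_iff]
    nlinarith [norm_nonneg (W.symm y)]
  · rintro _ ⟨T, rfl⟩ hK hne
    let L := W.symm.toContinuousLinearEquiv
    have hμ : (vol.map L).IsAddHaarMeasure := L.isAddHaarMeasure_map vol
    have hmap : ∀ s : Set (EuclideanSpace ℝ (Fin (Module.finrank ℝ V))),
        vol.map L s = vol (W '' s) := fun s => by
      rw [show (⇑L : V → _) = L.toHomeomorph.toMeasurableEquiv from rfl, MeasurableEquiv.map_apply]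
      congr 1
      exact (W.toEquiv.image_eq_preimage_symm s).symm
    have himg : ∀ s, W '' ((T.trans W.symm.toAffineEquiv) '' s) = T '' s := fun s => by
      rw [Set.image_image]
      simp
    have hmem : ∀ y, y ∈ convexHull ℝ S →
        W.symm y ∈ (T.trans W.symm.toAffineEquiv) '' Metric.closedBall 0 1 := fun y hy => by
      obtain ⟨z, hz, hzy⟩ := hK hy
      exact ⟨z, hz, by simp [hzy]⟩
    have := measure_closedBall_lt_of_tight_frame (vol.map L) (fun i => W.symm (x i)) w c hw0 hw
      (fun i => by
        have h := hx i
        rw [hnorm] at h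
        exact (pow_eq_one_iff_of_nonneg (norm_nonneg _) two_ne_zero).1 h)
      (fun v => by
        have h := hframe (W v)
        simpa only [hnorm, hW, LinearEquiv.symm_apply_apply] using h)
      (T.trans W.symm.toAffineEquiv) (fun i => hmem _ (hxS i))
      (fun i => by simpa using hmem _ (hxS' i))
      (fun h => hne (by rw [← himg, h]))
    rwa [hmap, hmap, himg] at this

end ScalarProduct

/-! ### Moments of quadratic forms over vectors of fourth roots of unity. -/

section Phases

open ComplexConjugate

noncomputable instance fintypeRootsOfUnityFour : Fintype (rootsOfUnity 4 ℂ) := Fintype.ofFinite _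

variable {n : Type*}

/-- The vector of fourth roots of unity given by `ε`. -/
def phaseVector (ε : n → rootsOfUnity 4 ℂ) (k : n) : ℂ := ((ε k : ℂˣ) : ℂ)

/-- The fourth root of unity `i`. -/
noncomputable def phaseI : rootsOfUnity 4 ℂ :=
  rootsOfUnity.mkOfPowEq Complex.I Complex.I_pow_four

theorem conj_mul_phaseVector (ε : n → rootsOfUnity 4 ℂ) (k : n) :
    conj (phaseVector ε k) * phaseVector ε k = 1 := by
  rw [← Complex.normSq_eq_conj_mul_self, Complex.normSq_eq_norm_sq, phaseVector,
    Complex.norm_eq_one_of_mem_rootsOfUnity (ε k).2]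
  simp

theorem phaseVector_mulSingle_mul [DecidableEq n] (ε : n → rootsOfUnity 4 ℂ) (j k : n) :
    phaseVector (Pi.mulSingle j phaseI * ε) k
      = if k = j then Complex.I * phaseVector ε k else phaseVector ε k := by
  unfold phaseVector
  by_cases h : k = j
  · subst h
    simp [phaseI]
  · simp [h]

variable [Fintype n] [DecidableEq n]

/-- Rotating coordinate `j` by `i` permutes the phase vectors, so the sum equals `c` times itself.
-/
theorem sum_eq_zero_of_mulSingle_phaseI (Φ : (n → rootsOfUnity 4 ℂ) → ℂ) (j : n) (c : ℂ)
    (hc : c ≠ 1) (h : ∀ ε, Φ (Pi.mulSingle j phaseI * ε) = c * Φ ε) : ∑ ε, Φ ε = 0 := by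
  have h1 : ∑ ε, Φ (Pi.mulSingle j phaseI * ε) = ∑ ε, Φ ε :=
    Fintype.sum_equiv (Equiv.mulLeft (Pi.mulSingle j phaseI)) _ _ fun _ => rfl
  simp_rw [h, ← Finset.mul_sum] at h1
  have h2 : (c - 1) * ∑ ε, Φ ε = 0 := by rw [sub_mul, h1]; ring
  exact (mul_eq_zero.1 h2).resolve_left (sub_ne_zero.2 hc)

theorem sum_conj_phaseVector_mul (j l : n) :
    ∑ ε, conj (phaseVector ε j) * phaseVector ε l
      = if j = l then (Fintype.card (n → rootsOfUnity 4 ℂ) : ℂ) else 0 := by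
  split_ifs with h
  · subst h
    simp only [conj_mul_phaseVector]
    simp [-Fintype.card_pi]
  · refine sum_eq_zero_of_mulSingle_phaseI _ l Complex.I
      (fun h => by simpa using congrArg Complex.re h) fun ε => ?_
    simp only [phaseVector_mulSingle_mul, h, if_false, if_true]
    ring

theorem sum_conj_phaseVector_mul_four (j l m p : n) :
    ∑ ε, conj (phaseVector ε j) * phaseVector ε l * (conj (phaseVector ε m) * phaseVector ε p)
      = Fintype.card (n → rootsOfUnity 4 ℂ) *
        (((if j = l then if m = p then 1 else 0 else 0)
          + (if j = p then if l = m then 1 else 0 else 0))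
          - (if j = l then if m = p then if j = m then 1 else 0 else 0 else 0)) := by
  by_cases hjl : j = l
  · subst hjl
    simp only [conj_mul_phaseVector, one_mul, sum_conj_phaseVector_mul]
    by_cases hmp : m = p
    · subst hmp; by_cases h : j = m <;> simp [h]
    · have : ¬ (j = p ∧ j = m) := fun h => hmp (h.2.symm.trans h.1)
      simp only [hmp, if_true, if_false, ← ite_and, this]
      simp
  by_cases hjp : j = p
  · subst hjp
    have : ∀ ε : n → rootsOfUnity 4 ℂ, conj (phaseVector ε j) * phaseVector ε l *
        (conj (phaseVector ε m) * phaseVector ε j) = conj (phaseVector ε m) * phaseVector ε l :=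
      fun ε => by
        linear_combination (conj (phaseVector ε m) * phaseVector ε l) * conj_mul_phaseVector ε j
    simp only [this, sum_conj_phaseVector_mul]
    simp [hjl, eq_comm]
  · simp only [hjl, hjp, if_false]
    rw [add_zero, sub_zero, mul_zero]
    -- Only conjugated factors involve coordinate `j`: one gives `-i`, two give `(-i)² = -1`. Signs
    -- `±1` would not suffice, since two factors would then give `1`.
    refine sum_eq_zero_of_mulSingle_phaseI _ j (if m = j then -1 else -Complex.I) ?_ fun ε => ?_
    · split_ifs
      · norm_num
      · exact fun h => by simpa using congrArg Complex.re h
    · simp only [phaseVector_mulSingle_mul, Ne.symm hjl, Ne.symm hjp, if_false, if_true]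
      split_ifs
      · simp only [map_mul, Complex.conj_I]
        linear_combination (conj (phaseVector ε j) * phaseVector ε l *
          (conj (phaseVector ε m) * phaseVector ε p)) * Complex.I_sq
      · simp only [map_mul, Complex.conj_I]
        ring

omit [DecidableEq n] in
theorem phaseVector_dotProduct_mulVec (A : Matrix n n ℂ) (ε : n → rootsOfUnity 4 ℂ) :
    star (phaseVector ε) ⬝ᵥ A.mulVec (phaseVector ε)
      = ∑ q : n × n, A q.1 q.2 * (conj (phaseVector ε q.1) * phaseVector ε q.2) := by
  simp only [dotProduct, Matrix.mulVec, Finset.mul_sum, Pi.star_apply, Fintype.sum_prod_type]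
  exact Finset.sum_congr rfl fun j _ => Finset.sum_congr rfl fun l _ => by
    rw [starRingEnd_apply]; ring

/-- The first moment of the quadratic form of `A` over phase vectors. -/
theorem sum_phaseVector_dotProduct_mulVec (A : Matrix n n ℂ) :
    ∑ ε, star (phaseVector ε) ⬝ᵥ A.mulVec (phaseVector ε)
      = Fintype.card (n → rootsOfUnity 4 ℂ) * A.trace := by
  simp_rw [phaseVector_dotProduct_mulVec]
  rw [Finset.sum_comm]
  simp_rw [← Finset.mul_sum, sum_conj_phaseVector_mul, Fintype.sum_prod_type]
  simp [Matrix.trace, ← Finset.sum_mul, mul_comm, -Fintype.card_pi]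

/-- The second moment of the quadratic form of `A` over phase vectors. -/
theorem sum_phaseVector_dotProduct_mulVec_sq (A : Matrix n n ℂ) :
    ∑ ε, (star (phaseVector ε) ⬝ᵥ A.mulVec (phaseVector ε)) ^ 2
      = Fintype.card (n → rootsOfUnity 4 ℂ) *
        (A.trace ^ 2 + (A * A).trace - ∑ j, A j j ^ 2) := by
  simp_rw [phaseVector_dotProduct_mulVec, sq, Finset.sum_mul_sum]
  rw [Finset.sum_comm]
  have h : ∀ q r : n × n, ∑ ε, A q.1 q.2 * (conj (phaseVector ε q.1) * phaseVector ε q.2) *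
      (A r.1 r.2 * (conj (phaseVector ε r.1) * phaseVector ε r.2))
      = Fintype.card (n → rootsOfUnity 4 ℂ) * (A q.1 q.2 * A r.1 r.2 *
        (((if q.1 = q.2 then if r.1 = r.2 then 1 else 0 else 0)
          + (if q.1 = r.2 then if q.2 = r.1 then 1 else 0 else 0))
          - (if q.1 = q.2 then if r.1 = r.2 then if q.1 = r.1 then 1 else 0 else 0 else 0))) :=
    fun q r => by
      rw [mul_left_comm, ← sum_conj_phaseVector_mul_four, Finset.mul_sum]
      exact Finset.sum_congr rfl fun ε _ => by ring
  simp_rw [Finset.sum_comm (s := (Finset.univ : Finset (n → rootsOfUnity 4 ℂ))), h,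
    ← Finset.mul_sum]
  congr 1
  simp only [Fintype.sum_prod_type, mul_sub, mul_add, Finset.sum_sub_distrib,
    Finset.sum_add_distrib, mul_ite, mul_one, mul_zero, Finset.sum_ite_eq, Finset.mem_univ,
    if_true, Finset.sum_ite_irrel, Finset.sum_const_zero]
  simp [Matrix.trace, Matrix.mul_apply, Finset.sum_mul_sum]

end Phases

/-! ### Trace inequalities, the Löwner form and the 2-design. -/

section HermitianSpace

variable {D : ℕ}

/-- The real part of the trace of a Hermitian matrix is the sum of its real diagonal entries. -/
theorem re_trace_eq_sum (A : Matrix (Fin D) (Fin D) ℂ) : A.trace.re = ∑ j, (A j j).re := by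
  simp [Matrix.trace]

theorem Matrix.IsHermitian.re_trace_mul_self {A : Matrix (Fin D) (Fin D) ℂ} (hA : A.IsHermitian) :
    (A * A).trace.re = ∑ i, ∑ j, Complex.normSq (A i j) := by
  simp only [Matrix.trace, Matrix.diag_apply, Matrix.mul_apply, Complex.re_sum]
  refine Finset.sum_congr rfl fun i _ => Finset.sum_congr rfl fun j _ => ?_
  rw [← hA.apply j i, Complex.star_def, Complex.mul_conj, Complex.ofReal_re]

theorem Matrix.IsHermitian.re_trace_sq_le {A : Matrix (Fin D) (Fin D) ℂ} (hA : A.IsHermitian) :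
    A.trace.re ^ 2 ≤ D * (A * A).trace.re := by
  rw [hA.re_trace_mul_self, re_trace_eq_sum]
  have h1 : (∑ j, (A j j).re) ^ 2 ≤ D * ∑ j, (A j j).re ^ 2 := by
    simpa using sq_sum_le_card_mul_sum_sq (s := Finset.univ) (f := fun j => (A j j).re)
  refine h1.trans (mul_le_mul_of_nonneg_left (Finset.sum_le_sum fun i _ => ?_) (Nat.cast_nonneg _))
  calc (A i i).re ^ 2 ≤ Complex.normSq (A i i) := by
        rw [Complex.normSq_apply]; nlinarith [mul_self_nonneg (A i i).im]
    _ ≤ _ := Finset.single_le_sum (f := fun j => Complex.normSq (A i j))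
        (fun j _ => Complex.normSq_nonneg _) (Finset.mem_univ i)

theorem Matrix.IsHermitian.re_trace_mul_self_pos {A : Matrix (Fin D) (Fin D) ℂ}
    (hA : A.IsHermitian) (h0 : A ≠ 0) : 0 < (A * A).trace.re := by
  have hnn : ∀ i, 0 ≤ ∑ j, Complex.normSq (A i j) := fun i =>
    Finset.sum_nonneg fun j _ => Complex.normSq_nonneg _
  rw [hA.re_trace_mul_self]
  refine (Finset.sum_nonneg fun i _ => hnn i).lt_of_ne fun h => h0 ?_
  ext i j
  have h1 := (Finset.sum_eq_zero_iff_of_nonneg fun i _ => hnn i).1 h.symm i (Finset.mem_univ i)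
  have h2 := (Finset.sum_eq_zero_iff_of_nonneg fun j _ => Complex.normSq_nonneg (A i j)).1 h1 j
    (Finset.mem_univ j)
  simpa using h2

/-- Nonnegativity of the 2 × 2 principal minor on `i, j`; for `i = j` the repeated index is
harmless. -/
theorem Matrix.PosSemidef.normSq_apply_le {A : Matrix (Fin D) (Fin D) ℂ} (hA : A.PosSemidef)
    (i j : Fin D) : Complex.normSq (A i j) ≤ (A i i).re * (A j j).re := by
  have h := (hA.submatrix ![i, j]).det_nonneg
  rw [Matrix.det_fin_two] at h
  have hr := (Complex.le_def.1 h).1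
  have hi : ∀ k, (A k k).im = 0 := fun k => by
    have := congrArg Complex.im (hA.1.apply k k)
    simp only [Complex.star_def, Complex.conj_im] at this
    linarith
  simp only [Matrix.submatrix_apply, Matrix.cons_val_zero, Matrix.cons_val_one] at hr
  rw [← hA.1.apply j i, Complex.star_def, Complex.mul_conj] at hr
  simp [hi] at hr
  linarith

theorem Matrix.PosSemidef.re_trace_mul_self_le {A : Matrix (Fin D) (Fin D) ℂ}
    (hA : A.PosSemidef) : (A * A).trace.re ≤ A.trace.re ^ 2 := by
  rw [hA.1.re_trace_mul_self, re_trace_eq_sum, sq, Finset.sum_mul_sum]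
  exact Finset.sum_le_sum fun i _ => Finset.sum_le_sum fun j _ => hA.normSq_apply_le i j

/-- The rank one Hermitian matrix `ψ ψ*`. -/
def rankOneHermitian (ψ : Fin D → ℂ) : HermitianSpace D :=
  ⟨Matrix.vecMulVec ψ (star ψ), (Matrix.posSemidef_vecMulVec_self_star ψ).1⟩

theorem trace_mul_rankOneHermitian (A : Matrix (Fin D) (Fin D) ℂ) (ψ : Fin D → ℂ) :
    (A * (rankOneHermitian ψ : Matrix (Fin D) (Fin D) ℂ)).trace = star ψ ⬝ᵥ A.mulVec ψ := by
  rw [rankOneHermitian, Matrix.mul_vecMulVec, Matrix.trace_vecMulVec, dotProduct_comm]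

theorem trace_rankOneHermitian (ψ : Fin D → ℂ) :
    (rankOneHermitian ψ : Matrix (Fin D) (Fin D) ℂ).trace = star ψ ⬝ᵥ ψ := by
  rw [rankOneHermitian, Matrix.trace_vecMulVec, dotProduct_comm]

theorem rankOneHermitian_mem_states {ψ : Fin D → ℂ} (hψ : star ψ ⬝ᵥ ψ = 1) :
    rankOneHermitian ψ ∈ states D :=
  ⟨Matrix.posSemidef_vecMulVec_self_star ψ, by rw [trace_rankOneHermitian, hψ]⟩

/-- The quadratic form of a Hermitian matrix takes real values. -/
theorem Matrix.IsHermitian.ofReal_re_dotProduct_mulVec {A : Matrix (Fin D) (Fin D) ℂ}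
    (hA : A.IsHermitian) (ψ : Fin D → ℂ) :
    ((star ψ ⬝ᵥ A.mulVec ψ).re : ℂ) = star ψ ⬝ᵥ A.mulVec ψ := by
  rw [← Complex.conj_eq_iff_re, ← Complex.star_def]
  conv_lhs => rw [Matrix.star_dotProduct, star_star, Matrix.star_mulVec, hA.eq,
    ← Matrix.dotProduct_mulVec]

/-- The scalar product of the Löwner ellipsoid of `symmStates D`. -/
noncomputable def lownerForm (A B : HermitianSpace D) : ℝ :=
  (1 + 1 / (D : ℝ)) *
      ((A : Matrix (Fin D) (Fin D) ℂ) * (B : Matrix (Fin D) (Fin D) ℂ)).trace.re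
    - 1 / (D : ℝ) * (A : Matrix (Fin D) (Fin D) ℂ).trace.re
      * (B : Matrix (Fin D) (Fin D) ℂ).trace.re

theorem lownerForm_comm (A B : HermitianSpace D) : lownerForm A B = lownerForm B A := by
  rw [lownerForm, lownerForm, Matrix.trace_mul_comm]
  ring

theorem lownerForm_add_left (A B C : HermitianSpace D) :
    lownerForm (A + B) C = lownerForm A C + lownerForm B C := by
  simp only [lownerForm, AddSubgroup.coe_add, add_mul, Matrix.trace_add, Complex.add_re]
  ring

theorem lownerForm_smul_left (r : ℝ) (A B : HermitianSpace D) :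
    lownerForm (r • A) B = r * lownerForm A B := by
  simp only [lownerForm, selfAdjoint.val_smul, Matrix.smul_mul, Matrix.trace_smul, Complex.smul_re,
    smul_eq_mul]
  ring

/-- Cauchy–Schwarz, `(tr A)² ≤ D tr A²`, leaves at least `tr A² / D > 0`. -/
theorem lownerForm_self_pos (hD : 1 ≤ D) (A : HermitianSpace D) (hA : A ≠ 0) :
    0 < lownerForm A A := by
  have hH : (A : Matrix (Fin D) (Fin D) ℂ).IsHermitian := A.2
  have h1 := hH.re_trace_sq_le
  have h2 := hH.re_trace_mul_self_pos fun h => hA (Subtype.ext h)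
  have hD' : (0 : ℝ) < D := by exact_mod_cast hD
  rw [lownerForm]
  have h3 : 1 / (D : ℝ) * (A : Matrix (Fin D) (Fin D) ℂ).trace.re ^ 2
      ≤ ((A : Matrix (Fin D) (Fin D) ℂ) * (A : Matrix (Fin D) (Fin D) ℂ)).trace.re := by
    rw [one_div, inv_mul_le_iff₀ hD']
    exact h1
  have h4 : 0 < 1 / (D : ℝ) := by positivity
  nlinarith

/-- A state has `tr ρ² ≤ (tr ρ)² = 1`, so the form is at most `(1 + 1/D) - 1/D`. -/
theorem lownerForm_self_le_one (A : HermitianSpace D) (hA : A ∈ states D ∪ -states D) :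
    lownerForm A A ≤ 1 := by
  have key : ∀ B ∈ states D, lownerForm B B ≤ 1 := fun B hB => by
    have h1 := hB.1.re_trace_mul_self_le
    rw [lownerForm]
    rw [hB.2] at h1 ⊢
    have h4 : 0 ≤ 1 / (D : ℝ) := by positivity
    simp only [Complex.one_re] at h1 ⊢
    nlinarith
  rcases hA with hA | hA
  · exact key A hA
  · have h1 := key (-A) hA
    rw [← neg_one_smul ℝ A, lownerForm_smul_left, lownerForm_comm, lownerForm_smul_left] at h1
    linarith

theorem lownerForm_rankOneHermitian (A : HermitianSpace D) {ψ : Fin D → ℂ}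
    (hψ : star ψ ⬝ᵥ ψ = 1) :
    lownerForm A (rankOneHermitian ψ)
      = (1 + 1 / (D : ℝ)) * (star ψ ⬝ᵥ (A : Matrix (Fin D) (Fin D) ℂ).mulVec ψ).re
        - 1 / (D : ℝ) * (A : Matrix (Fin D) (Fin D) ℂ).trace.re := by
  rw [lownerForm, trace_mul_rankOneHermitian, trace_rankOneHermitian, hψ, Complex.one_re, mul_one]

theorem lownerForm_rankOneHermitian_self {ψ : Fin D → ℂ} (hψ : star ψ ⬝ᵥ ψ = 1) :
    lownerForm (rankOneHermitian ψ) (rankOneHermitian ψ) = 1 := by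
  rw [lownerForm_rankOneHermitian _ hψ, trace_rankOneHermitian, hψ, rankOneHermitian,
    Matrix.vecMulVec_mulVec]
  simp [hψ]

/-- The unit vectors of a weighted complex projective 2-design: the standard basis and the
normalised phase vectors. -/
noncomputable def designVector : Fin D ⊕ (Fin D → rootsOfUnity 4 ℂ) → Fin D → ℂ
  | Sum.inl j => Pi.single j 1
  | Sum.inr ε => ((Real.sqrt D)⁻¹ : ℝ) • phaseVector ε

/-- The weights of the 2-design `designVector`. -/
noncomputable def designWeight : Fin D ⊕ (Fin D → rootsOfUnity 4 ℂ) → ℝ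
  | Sum.inl _ => 1 / (D * (D + 1))
  | Sum.inr _ => D / ((D + 1) * Fintype.card (Fin D → rootsOfUnity 4 ℂ))

theorem designVector_inr_dotProduct_mulVec (A : Matrix (Fin D) (Fin D) ℂ)
    (ε : Fin D → rootsOfUnity 4 ℂ) :
    star (designVector (Sum.inr ε)) ⬝ᵥ A.mulVec (designVector (Sum.inr ε))
      = ((D : ℝ)⁻¹ : ℝ) • (star (phaseVector ε) ⬝ᵥ A.mulVec (phaseVector ε)) := by
  rw [designVector, Matrix.mulVec_smul, star_smul, smul_dotProduct, dotProduct_smul, smul_smul,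
    star_trivial, ← mul_inv, Real.mul_self_sqrt (Nat.cast_nonneg _)]

theorem star_designVector_dotProduct (hD : 1 ≤ D) (i : Fin D ⊕ (Fin D → rootsOfUnity 4 ℂ)) :
    star (designVector i) ⬝ᵥ designVector i = 1 := by
  cases i with
  | inl j => simp [designVector]
  | inr ε =>
    have h := designVector_inr_dotProduct_mulVec 1 ε
    rw [Matrix.one_mulVec, Matrix.one_mulVec] at h
    rw [h]
    have h2 : star (phaseVector ε) ⬝ᵥ phaseVector ε = D := by
      simp [dotProduct, ← starRingEnd_apply, conj_mul_phaseVector]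
    have hD' : (D : ℂ) ≠ 0 := by exact_mod_cast (by omega : D ≠ 0)
    rw [h2]
    simp [hD']

theorem sum_designWeight (hD : 1 ≤ D) : ∑ i, designWeight (D := D) i = 1 := by
  have hD' : (0 : ℝ) < D := by exact_mod_cast hD
  have hN : (Fintype.card (Fin D → rootsOfUnity 4 ℂ) : ℝ) ≠ 0 := by
    exact_mod_cast Fintype.card_ne_zero
  simp only [Fintype.sum_sum_type, designWeight, Finset.sum_const, Finset.card_univ, nsmul_eq_mul,
    Fintype.card_fin]
  field_simp
  ring

/-- The 2-design is a tight frame for the scalar product `lownerForm`. -/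
theorem sum_designWeight_mul_lownerForm_sq (hD : 1 ≤ D) (A : HermitianSpace D) :
    ∑ i, designWeight i * lownerForm A (rankOneHermitian (designVector i)) ^ 2
      = 1 / (D : ℝ) ^ 2 * lownerForm A A := by
  have hD' : (0 : ℝ) < D := by exact_mod_cast hD
  have hH : (A : Matrix (Fin D) (Fin D) ℂ).IsHermitian := A.2
  set M : Matrix (Fin D) (Fin D) ℂ := A.1 with hM
  set N : ℝ := (Fintype.card (Fin D → rootsOfUnity 4 ℂ) : ℝ) with hNdef
  have hN : N ≠ 0 := by
    rw [hNdef]; exact_mod_cast Fintype.card_ne_zero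
  set g : (Fin D → rootsOfUnity 4 ℂ) → ℝ :=
    fun ε => (star (phaseVector ε) ⬝ᵥ M.mulVec (phaseVector ε)).re with hg
  set a : Fin D → ℝ := fun j => (M j j).re with ha
  have hgc : ∀ ε, star (phaseVector ε) ⬝ᵥ M.mulVec (phaseVector ε) = (g ε : ℂ) := fun ε =>
    (hH.ofReal_re_dotProduct_mulVec _).symm
  have hac : ∀ j, M j j = (a j : ℂ) := fun j => (hH.coe_re_apply_self j).symm
  have ht : M.trace = ((∑ j, a j : ℝ) : ℂ) := by
    simp [Matrix.trace, hac]
  have hg1 : ∑ ε, g ε = N * ∑ j, a j := by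
    have h := congrArg Complex.re (sum_phaseVector_dotProduct_mulVec M)
    simp only [hgc, ht] at h
    exact_mod_cast h
  have hg2 : ∑ ε, g ε ^ 2 = N * ((∑ j, a j) ^ 2 + (M * M).trace.re - ∑ j, a j ^ 2) := by
    have h := congrArg Complex.re (sum_phaseVector_dotProduct_mulVec_sq M)
    simp only [hgc, ht, hac, ← Complex.ofReal_natCast, ← Complex.ofReal_pow, ← Complex.ofReal_sum,
      Complex.re_ofReal_mul, Complex.sub_re, Complex.add_re, Complex.ofReal_re] at h
    exact h
  have htr : M.trace.re = ∑ j, a j := by rw [ht, Complex.ofReal_re]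
  have hinl : ∀ j, lownerForm A (rankOneHermitian (designVector (Sum.inl j)))
      = (1 + 1 / (D : ℝ)) * a j - 1 / D * ∑ j, a j := fun j => by
    rw [lownerForm_rankOneHermitian _ (star_designVector_dotProduct hD _), ← hM, htr]
    simp [designVector, ha]
  have hinr : ∀ ε, lownerForm A (rankOneHermitian (designVector (Sum.inr ε)))
      = (1 + 1 / (D : ℝ)) / D * g ε - 1 / D * ∑ j, a j := fun ε => by
    rw [lownerForm_rankOneHermitian _ (star_designVector_dotProduct hD _), ← hM, htr,
      designVector_inr_dotProduct_mulVec, Complex.smul_re, smul_eq_mul]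
    ring
  have hsq : ∀ (κ : Type) [Fintype κ] (f : κ → ℝ) (p q v : ℝ),
      ∑ k, v * (p * f k - q) ^ 2
        = v * (p ^ 2 * ∑ k, f k ^ 2 - 2 * p * q * ∑ k, f k + Fintype.card κ * q ^ 2) :=
    fun κ _ f p q v => by
      have : ∀ k, v * (p * f k - q) ^ 2
          = v * p ^ 2 * f k ^ 2 - v * 2 * p * q * f k + v * q ^ 2 := fun k => by ring
      simp only [this, Finset.sum_add_distrib, Finset.sum_sub_distrib, ← Finset.mul_sum,
        Finset.sum_const, Finset.card_univ, nsmul_eq_mul]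
      ring
  simp only [Fintype.sum_sum_type, hinl, hinr, designWeight]
  -- The weights make the basis vectors' `∑ a j ^ 2` cancel the defect in the phase moment, leaving
  -- the second moment `((tr A)² + tr A²) / (D (D + 1))`. The constant `1 / D²` is `1 / dim V`.
  rw [hsq, hsq, hg1, hg2, ← hNdef, Fintype.card_fin, lownerForm, ← hM, htr]
  field_simp
  ring

end HermitianSpace

theorem lemma7 (D : ℕ) (hD : 1 ≤ D)
    [MeasurableSpace (HermitianSpace D)] [BorelSpace (HermitianSpace D)]
    (vol : MeasureTheory.Measure (HermitianSpace D)) [vol.IsAddHaarMeasure] :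
    ∃ E : Set (HermitianSpace D),
      IsLownerEllipsoid vol (symmStates D) E ∧
      IsScalarProductOf E (fun A B : HermitianSpace D =>
        (1 + 1 / (D : ℝ)) *
            ((A : Matrix (Fin D) (Fin D) ℂ) * (B : Matrix (Fin D) (Fin D) ℂ)).trace.re
          - 1 / (D : ℝ) * (A : Matrix (Fin D) (Fin D) ℂ).trace.re
            * (B : Matrix (Fin D) (Fin D) ℂ).trace.re) := by
  have hmem := fun i => rankOneHermitian_mem_states (star_designVector_dotProduct hD i)
  have : FiniteDimensional ℝ (Matrix (Fin D) (Fin D) ℂ) :=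
    FiniteDimensional.trans ℝ ℂ _
  have : FiniteDimensional ℝ (HermitianSpace D) :=
    inferInstanceAs (FiniteDimensional ℝ (selfAdjoint.submodule ℝ (Matrix (Fin D) (Fin D) ℂ)))
  have : ContinuousSMul ℝ (HermitianSpace D) :=
    inferInstanceAs (ContinuousSMul ℝ (selfAdjoint.submodule ℝ (Matrix (Fin D) (Fin D) ℂ)))
  exact exists_isLownerEllipsoid_isScalarProductOf vol lownerForm lownerForm_comm
    lownerForm_add_left lownerForm_smul_left (lownerForm_self_pos hD) lownerForm_self_le_one
    (fun i => rankOneHermitian (designVector i)) designWeight (1 / (D : ℝ) ^ 2)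
    (fun i => by cases i <;> simp only [designWeight] <;> positivity) (sum_designWeight hD)
    (fun i => lownerForm_rankOneHermitian_self (star_designVector_dotProduct hD i))
    (sum_designWeight_mul_lownerForm_sq hD)
    (fun i => subset_convexHull ℝ _ (Or.inl (hmem i)))
    (fun i => subset_convexHull ℝ _ (Or.inr (by simpa using hmem i)))
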